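/- Let $n\ge 1$ be an integer such that the modular curve $X_0(n)+n$ (the compactification of $(\Gamma_0(n)+n)\backslash\mathbb H$, where $\Gamma_0(n)+n$ is generated by $\Gamma_0(n)$ and the Fricke involution $\tau\mapsto -1/(n\tau)$) has genus $0$. For $i=1,2$ let $$y^2=4x^3-g_2^{(i)}(t)\,x-g_3^{(i)}(t)$$ be a pencil of elliptic curves over $\mathbb P^1_t$ in Weierstrass normal form, where $g_2^{(i)},g_3^{(i)}$ are rational functions of $t$ or, more generally, branches of algebraic functions of $t$. Let $U\subset\mathbb C$ be a nonempty connected open set of values of $t$ on which all these functions are holomorphic and both discriminants $\Delta_i=(g_2^{(i)})^3-27(g_3^{(i)})^2$ are nowhere zero (for rational $g_2^{(i)},g_3^{(i)}$ one may take $U$ to be the complement of a finite subset of $\mathbb C$). Assume that the functional invariants $j_i=(g_2^{(i)})^3/\Delta_i$ are nonconstant on $U$, and that for every $t\in U$ there is an isogeny of degree $n$ from the fibre of the first pencil over $t$ to the fibre of the second pencil over $t$. Then each pencil has a Picard–Fuchs operator, that is, an operator $\frac{d^2}{dt^2}+a_1(t)\frac{d}{dt}+a_0(t)$ with coefficients meromorphic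 on $U$ which annihilates all holomorphic period functions $\int_{\gamma(t)}\frac{dx}{y}$ of the pencil, and the projective normal forms $$\frac{d^2}{dt^2}+\Bigl(a_0-\tfrac12 a_1'-\tfrac14 a_1^2\Bigr)$$ of the Picard–Fuchs operators of the two pencils are identical. -/

import Mathlib

open Filter

/-- `f` is (a branch on `U` of) an algebraic function of `t`: it satisfies a nontrivial polynomial
relation `P(t, f(t)) = 0`. Every rational function of `t` without poles in `U` is of this kind. -/
def IsAlgebraicFunctionOn (f : ℂ → ℂ) (U : Set ℂ) : Prop :=
  ∃ P : Polynomial (Polynomial ℂ), P ≠ 0 ∧ ∀ t ∈ U, P.evalEval t (f t) = 0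

/-- A pencil of elliptic curves `y² = 4x³ - g₂(t) x - g₃(t)` in Weierstrass normal form over
`ℙ¹_t`, restricted to a set `U` of values of the parameter over which its fibres are smooth.
For an ordinary pencil over `ℙ¹_t`, `g₂` and `g₃` are rational functions of `t` and `U` may be the
complement in `ℂ` of the finitely many poles of `g₂`, `g₃` and zeros of `g₂³ - 27 g₃²`. Branches
of algebraic functions are allowed as well, since the functional invariants of two isogenous
pencils need not be rational themselves when only their symmetric functions are. -/
structure EllipticPencil (U : Set ℂ) where
  g₂ : ℂ → ℂ
  g₃ : ℂ → ℂ
  analytic_g₂ : AnalyticOnNhd ℂ g₂ U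
  analytic_g₃ : AnalyticOnNhd ℂ g₃ U
  algebraic_g₂ : IsAlgebraicFunctionOn g₂ U
  algebraic_g₃ : IsAlgebraicFunctionOn g₃ U
  disc_ne_zero : ∀ t ∈ U, g₂ t ^ 3 - 27 * g₃ t ^ 2 ≠ 0

/-- A second order linear differential operator `d²/dt² + a₁(t) d/dt + a₀(t)`. -/
structure DiffOp where
  a₁ : ℂ → ℂ
  a₀ : ℂ → ℂ

namespace DiffOp

/-- The coefficients are meromorphic on `U`. -/
def IsMeromorphicOn (D : DiffOp) (U : Set ℂ) : Prop :=
  MeromorphicOn D.a₁ U ∧ MeromorphicOn D.a₀ U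

/-- The operator applied to a function. -/
noncomputable def apply (D : DiffOp) (f : ℂ → ℂ) : ℂ → ℂ :=
  fun t => deriv (deriv f) t + D.a₁ t * deriv f t + D.a₀ t * f t

/-- The projective normal form: the operator `d²/dt² + (a₀ - a₁'/2 - a₁²/4)` without first order
term whose solutions are `exp (½ ∫ a₁) · f`, for `f` a solution of the given operator. -/
noncomputable def projectiveNormalForm (D : DiffOp) : DiffOp where
  a₁ := 0
  a₀ := fun t => D.a₀ t - deriv D.a₁ t / 2 - D.a₁ t ^ 2 / 4

/-- Two operators with meromorphic coefficients on `U` are identical: their coefficients are equal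
as meromorphic functions, i.e. away from a discrete subset of `U` (poles carry no values). -/
def Identical (U : Set ℂ) (D D' : DiffOp) : Prop :=
  D.a₁ =ᶠ[codiscreteWithin U] D'.a₁ ∧ D.a₀ =ᶠ[codiscreteWithin U] D'.a₀

end DiffOp

namespace EllipticPencil

variable {U : Set ℂ}

/-- The functional invariant `j = g₂³ / (g₂³ - 27 g₃²)`, normalized so that `j(i) = 1`. -/
noncomputable def j (E : EllipticPencil U) (t : ℂ) : ℂ :=
  E.g₂ t ^ 3 / (E.g₂ t ^ 3 - 27 * E.g₃ t ^ 2)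

/-- The functional invariant is not constant on `U`. -/
def NonconstantJ (E : EllipticPencil U) : Prop :=
  ¬ ∃ c : ℂ, ∀ t ∈ U, E.j t = c

/-- `L` spans the period lattice of the fibre over `t`: the lattice invariants
`g₂(L) = 60 ∑ ω⁻⁴` and `g₃(L) = 140 ∑ ω⁻⁶` are the coefficients of the fibre, so that
`z ↦ (℘(z), ℘'(z))` identifies `ℂ / L` with the fibre and `dz` with `dx / y`; the elements of the
lattice are the periods of `dx / y`. -/
def IsPeriodPairAt (E : EllipticPencil U) (t : ℂ) (L : PeriodPair) : Prop :=
  L.g₂ = E.g₂ t ∧ L.g₃ = E.g₃ t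

/-- `f` is a (local) period function on `V`: it is holomorphic, and its value at each `t` is a
period of `dx / y` on the fibre over `t`. -/
def IsPeriodFunctionOn (E : EllipticPencil U) (f : ℂ → ℂ) (V : Set ℂ) : Prop :=
  AnalyticOnNhd ℂ f V ∧ ∀ t ∈ V, ∃ L : PeriodPair, E.IsPeriodPairAt t L ∧ f t ∈ L.lattice

/-- `D` is the Picard--Fuchs operator: it has meromorphic coefficients and annihilates all period
functions on open subsets of the base. -/
def IsPicardFuchs (E : EllipticPencil U) (D : DiffOp) : Prop :=
  D.IsMeromorphicOn U ∧
    ∀ V : Set ℂ, IsOpen V → V ⊆ U → ∀ f : ℂ → ℂ, E.IsPeriodFunctionOn f V →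
      D.apply f =ᶠ[codiscreteWithin V] 0

end EllipticPencil

/-- There is an isogeny `ℂ / Λ₁ → ℂ / Λ₂` of degree `n`, that is, multiplication by some `α ≠ 0`
with `α Λ₁ ⊆ Λ₂` and `[Λ₂ : α Λ₁] = n` (this index is the order of the kernel `α⁻¹ Λ₂ / Λ₁`). -/
def AdmitsIsogeny (n : ℕ) (L₁ L₂ : PeriodPair) : Prop :=
  ∃ α : ℂ, α ≠ 0 ∧
    L₁.lattice.toAddSubgroup.map (AddMonoidHom.mulLeft α) ≤ L₂.lattice.toAddSubgroup ∧
    (L₁.lattice.toAddSubgroup.map (AddMonoidHom.mulLeft α)).relIndex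
      L₂.lattice.toAddSubgroup = n

/-- For each `t` in `U`, there is an isogeny of degree `n` from the fibre of `E₁` over `t` to the
fibre of `E₂` over `t`. -/
def AdmitFiberwiseIsogeny {U : Set ℂ} (n : ℕ) (E₁ E₂ : EllipticPencil U) : Prop :=
  ∀ t ∈ U, ∃ L₁ L₂ : PeriodPair,
    E₁.IsPeriodPairAt t L₁ ∧ E₂.IsPeriodPairAt t L₂ ∧ AdmitsIsogeny n L₁ L₂

/-- The group `Γ₀(n)+n` inside `SL(2, ℝ)`: generated by `Γ₀(n)` and the Fricke involution
`τ ↦ -1 / (n τ)`, given by the matrix `((0, -1/√n), (√n, 0))`. -/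
noncomputable def gamma0Plus (n : ℕ) : Subgroup (Matrix.SpecialLinearGroup (Fin 2) ℝ) :=
  (CongruenceSubgroup.Gamma0 n).map (Matrix.SpecialLinearGroup.map (Int.castRingHom ℝ)) ⊔
    Subgroup.closure {w : Matrix.SpecialLinearGroup (Fin 2) ℝ |
      (w : Matrix (Fin 2) (Fin 2) ℝ) = !![0, -(1 / √(n : ℝ)); √(n : ℝ), 0]}

/-- The genus of the modular curve `X₀(n)+n`, the compactification of `(Γ₀(n)+n) \ ℍ`: the
dimension of its space of holomorphic differentials `f(τ) dτ`, i.e. of the space of cusp forms of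
weight `2` for `Γ₀(n)+n`. -/
noncomputable def genusX0Plus (n : ℕ) : ℕ :=
  Module.finrank ℂ (CuspForm ((gamma0Plus n).map Matrix.SpecialLinearGroup.toGL) 2)

/-!
The argument is local and works with the period lattices of the fibres.

A lattice with oriented basis `(τ x, x)`, `τ` in the upper half plane, has invariants
`g₂ = (4π⁴/3) E₄(τ) / x⁴` and `g₃ = (8π⁶/27) E₆(τ) / x⁶`. By the Ramanujan identities, which are
derived here from the one-dimensionality of the spaces of modular forms of weights 4, 6 and 8, the
Jacobian of `(τ, x) ↦ (g₂, g₃)` is a nonzero multiple of `E₄³ - E₆²`, which vanishes nowhere. Hence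
a basis of the lattice of one fibre extends uniquely to holomorphic functions `(τ, x)` of the
parameter (`EllipticPencil.exists_isPeriodFrameAt`). The same identities show that `x` and the
quasi-period `π² E₂(τ) / x` satisfy the Gauss–Manin system, whose coefficients `P = Δ' / (12 Δ)` and
`w = (3 g₃ g₂' - 2 g₂ g₃') / (2 Δ)` depend on the pencil only. Eliminating the quasi-period gives an
explicit second order operator, with `w` in the denominators; `w` does not vanish identically
because the derivative of the functional invariant is a multiple of `w`.

The bases, the integral coordinates of a period and the integral matrix of an isogeny are at first
given for each `t` separately, without any continuity. They are tamed by a countability argument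
(`exists_frequently_mem_of_not_countable`): among uncountably many parameters there are some that
accumulate at a point `t₀` while the chosen bases converge to the one at `t₀` and the integers stay
constant. By uniqueness of the holomorphic extension and the identity theorem, a relation among the
chosen data then holds between holomorphic functions near `t₀`. Applied to a period function, this
shows that it is annihilated by the explicit operator on a dense set, hence everywhere.

Applied to the isogenies, it provides frames with `τ₁ (c τ₂ + d) = a τ₂ + b` for constant integers
near some `t₀`. With `α = (c τ₂ + d) x₂ / x₁`, the functions `α x₁` and `α τ₁ x₁` are periods of the
second pencil, while `x₁` and `τ₁ x₁` are independent periods of the first. Any Picard–Fuchs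
operators of the two pencils are therefore conjugate by `α` near `t₀`, so that their projective
normal forms agree there, and on all of the connected set `U` by the identity principle for
meromorphic functions.
-/

/-! ### The Ramanujan identities -/

section Ramanujan

open UpperHalfPlane hiding I
open Complex Topology MatrixGroups ModularForm EisensteinSeries Derivative Manifold

/-- A holomorphic function on `ℍ` with a `q`-expansion tends to the constant term at `i∞`. -/
lemma tendsto_atImInfty_of_hasSum_qExpansion {f : ℍ → ℂ} {c : ℕ → ℂ} (hf : MDiff f)
    (hsum : ∀ τ : ℍ, HasSum (fun m ↦ c m • Function.Periodic.qParam 1 (τ : ℂ) ^ m) (f τ)) :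
    Tendsto f atImInfty (𝓝 (c 0)) := by
  have hbdd : IsBoundedAtImInfty f := isBoundedAtImInfty_of_hasSum_qExpansion one_pos hsum
  have hper : Function.Periodic (f ∘ ofComplex) (1 : ℝ) := by
    intro w
    by_cases! hw : 0 < im w
    · have hw' : 0 < im (w + (1 : ℝ)) := by simpa using hw
      simp only [Function.comp_apply, ofComplex_apply_of_im_pos hw', ofComplex_apply_of_im_pos hw]
      refine (hsum _).unique ?_
      have hq : Function.Periodic.qParam 1 (w + (1 : ℝ)) = Function.Periodic.qParam 1 w := by
        simp only [Function.Periodic.qParam, ofReal_one, div_one]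
        rw [mul_add, mul_one, exp_add, exp_two_pi_mul_I, mul_one]
      have h := hsum ⟨w, hw⟩
      simp only [← hq] at h
      exact h
    · have : im (w + (1 : ℝ)) ≤ 0 := by simpa using hw
      rw [Function.comp_apply, Function.comp_apply, ofComplex_apply_of_im_nonpos this,
        ofComplex_apply_of_im_nonpos hw]
  have hps := hasFPowerSeriesOnBall_cuspFunction one_pos
    (analyticAt_cuspFunction_zero one_pos hper hf hbdd) hsum
  have h0 : cuspFunction 1 f 0 = c 0 := by
    simpa using (hps.hasFPowerSeriesAt.coeff_zero ![]).symm
  have hfq : f = cuspFunction 1 f ∘ fun τ : ℍ ↦ Function.Periodic.qParam 1 (τ : ℂ) := by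
    funext τ
    exact (eq_cuspFunction τ one_ne_zero hper).symm
  rw [hfq, ← h0]
  exact hps.hasFPowerSeriesAt.continuousAt.tendsto.comp (qParam_tendsto_atImInfty one_pos)

lemma tendsto_E2_atImInfty : Tendsto E2 atImInfty (𝓝 1) := by
  have h := tendsto_atImInfty_of_hasSum_qExpansion
    (c := fun m : ℕ ↦ (if m = 0 then 1 else -24 * (ArithmeticFunction.sigma 1 m : ℕ) : ℂ))
    E2_mdifferentiable
    (fun τ ↦ by
      simpa only [Function.Periodic.qParam, ofReal_one, div_one] using
        hasSum_qExpansion_E2 (z := τ))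
  simpa only [if_pos] using h

lemma tendsto_atImInfty_coeff_zero {k : ℤ} (f : ModularForm 𝒮ℒ k) :
    Tendsto f atImInfty (𝓝 ((qExpansion 1 f).coeff 0)) :=
  tendsto_atImInfty_of_hasSum_qExpansion (c := fun m ↦ (qExpansion 1 f).coeff m)
    (ModularFormClass.holo f) (hasSum_qExpansion one_pos
      (SlashInvariantFormClass.periodic_comp_ofComplex f one_mem_strictPeriods_SL)
      (ModularFormClass.holo f) (ModularFormClass.bdd_at_infty f))

lemma tendsto_E_atImInfty {k : ℕ} (hk : 3 ≤ k) (hk2 : Even k) :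
    Tendsto (E hk) atImInfty (𝓝 1) := by
  have h := tendsto_atImInfty_coeff_zero (E hk)
  rwa [E_qExpansion_coeff_zero hk hk2] at h

/-- By Cauchy's estimate, the derivative of a holomorphic function on `ℍ` with a limit at `i∞`
tends to zero. -/
lemma tendsto_normalizedDeriv_atImInfty {f : ℍ → ℂ} {c : ℂ} (hf : MDiff f)
    (hlim : Tendsto f atImInfty (𝓝 c)) : Tendsto (D f) atImInfty (𝓝 0) := by
  rw [Metric.tendsto_nhds] at hlim ⊢
  intro ε hε
  have h := hlim (ε / 2) (half_pos hε)
  rw [Filter.Eventually, atImInfty_mem] at h ⊢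
  obtain ⟨A, hA⟩ := h
  refine ⟨max A 0 + 1, fun z hz ↦ ?_⟩
  have hball : ∀ w ∈ Metric.closedBall (z : ℂ) 1, max A 0 ≤ w.im := by
    intro w hw
    have h1 : |(w - z).im| ≤ 1 :=
      (abs_im_le_norm _).trans (by simpa [dist_eq_norm] using hw)
    have h2 := (abs_le.mp h1).1
    have h3 : max A 0 + 1 ≤ (z : ℂ).im := hz
    simp only [sub_im] at h2
    linarith
  have hpos : ∀ w ∈ Metric.ball (z : ℂ) 1, 0 < w.im := by
    intro w hw
    have h1 : |(w - z).im| < 1 :=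
      (abs_im_le_norm _).trans_lt (by simpa [dist_eq_norm] using hw)
    have h2 := (abs_lt.mp h1).1
    have h3 : max A 0 + 1 ≤ (z : ℂ).im := hz
    have := le_max_right A 0
    simp only [sub_im] at h2
    linarith
  have hdiff : DifferentiableOn ℂ (fun w ↦ (f ∘ ofComplex) w - c) (Metric.ball (z : ℂ) 1) :=
    ((UpperHalfPlane.mdifferentiable_iff.mp hf).mono hpos).sub_const c
  have hd := norm_deriv_le_of_forall_mem_sphere_norm_le (c := (z : ℂ)) (R := 1 / 2) (C := ε / 2)
    (f := fun w ↦ (f ∘ ofComplex) w - c) (by norm_num)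
    ((hdiff.mono (Metric.closedBall_subset_ball (by norm_num))).diffContOnCl_ball subset_rfl) ?_
  · rw [deriv_sub_const] at hd
    have hpi : (1 : ℝ) ≤ Real.pi := by linarith [Real.pi_gt_three]
    simp only [dist_zero_right, normalizedDerivOfComplex, norm_mul, norm_inv, Set.mem_ofPred_eq]
    have : ‖(2 : ℂ)‖ * ‖(Real.pi : ℂ)‖ * ‖I‖ = 2 * Real.pi := by
      simp [abs_of_pos Real.pi_pos]
    rw [this]
    have hle : (2 * Real.pi)⁻¹ ≤ 1 / 2 := by
      rw [inv_le_comm₀ (by positivity) (by norm_num)]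
      linarith
    calc _ ≤ 1 / 2 * (ε / 2 / (1 / 2)) := by gcongr
      _ < ε := by linarith
  · intro w hw
    have hw' : w ∈ Metric.closedBall (z : ℂ) 1 := by
      rw [mem_sphere_iff_norm] at hw
      rw [mem_closedBall_iff_norm, hw]
      norm_num
    have hwp : 0 < w.im := hpos w (by
      rw [mem_sphere_iff_norm] at hw
      rw [mem_ball_iff_norm, hw]
      norm_num)
    have := hA ⟨w, hwp⟩ ((le_max_left A 0).trans (hball w hw'))
    simp only [Function.comp_apply, ofComplex_apply_of_im_pos hwp]
    rw [Set.mem_ofPred_eq, dist_eq_norm] at this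
    exact this.le

/-- A holomorphic function on `ℍ` invariant under the weight `k` action of `SL(2, ℤ)` with a limit
at `i∞` is a modular form of level one. -/
noncomputable def levelOneForm (k : ℤ) (f : ℍ → ℂ) (hf : MDiff f)
    (hinv : ∀ γ : SL(2, ℤ), f ∣[k] γ = f)
    {c : ℂ} (hlim : Tendsto f atImInfty (𝓝 c)) : ModularForm 𝒮ℒ k where
  toFun := f
  slash_action_eq' := fun _ ⟨γ, hγ⟩ ↦ hγ ▸ hinv γ
  holo' := hf
  bdd_at_cusps' {c} hc := by
    rw [Subgroup.IsArithmetic.isCusp_iff_isCusp_SL2Z] at hc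
    rw [OnePoint.isBoundedAt_iff_forall_SL2Z hc]
    intro γ _
    rw [hinv γ]
    exact hlim.isBigO_one ℝ

/-- If the space of modular forms of weight `k` is one-dimensional, a function as in `levelOneForm`
is the multiple of `E_k` with the same limit at `i∞`. -/
lemma eq_mul_E_of_tendsto {k : ℕ} (hk : 3 ≤ k) (hk2 : Even k)
    (hrank : Module.rank ℂ (ModularForm 𝒮ℒ k) = 1) (f : ℍ → ℂ) (hf : MDiff f)
    (hinv : ∀ γ : SL(2, ℤ), f ∣[(k : ℤ)] γ = f) {c : ℂ} (hlim : Tendsto f atImInfty (𝓝 c)) (z : ℍ) :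
    f z = c * E hk z := by
  obtain ⟨a, ha⟩ := (finrank_eq_one_iff_of_nonzero' (E hk) (E_ne_zero hk hk2)).mp
    (Module.rank_eq_one_iff_finrank_eq_one.mp hrank) (levelOneForm k f hf hinv hlim)
  have hfun : ∀ w, a * E hk w = f w := fun w ↦ congrArg (fun g : ModularForm 𝒮ℒ k ↦ g w) ha
  have hlim' : Tendsto f atImInfty (𝓝 (a * 1)) :=
    ((tendsto_E_atImInfty hk hk2).const_mul a).congr hfun
  rw [tendsto_nhds_unique hlim hlim', mul_one, hfun]

lemma slash_E {k : ℕ} (hk : 3 ≤ k) (γ : SL(2, ℤ)) : (E hk : ℍ → ℂ) ∣[(k : ℤ)] γ = E hk :=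
  SlashInvariantForm.slash_action_eqn (E hk) _ ⟨γ, rfl⟩

/-- The Ramanujan identity for `E₄`. -/
theorem normalizedDeriv_E₄ (z : ℍ) : D E₄ z = (E2 z * E₄ z - E₆ z) / 3 := by
  have hD := tendsto_normalizedDeriv_atImInfty E₄.holo' (tendsto_E_atImInfty _ ⟨2, rfl⟩)
  have hlim : Tendsto (serreDerivative (4 : ℤ) E₄) atImInfty (𝓝 (0 - (4 : ℤ) * 12⁻¹ * 1 * 1)) :=
    hD.sub ((tendsto_E2_atImInfty.const_mul _).mul (tendsto_E_atImInfty _ ⟨2, rfl⟩))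
  have h := eq_mul_E_of_tendsto (k := 6) (by norm_num) ⟨3, rfl⟩ levelOne_weight_six_rank_one
    (serreDerivative (4 : ℤ) E₄) (serreDerivative_mdifferentiable _ E₄.holo')
    (fun γ ↦ serreDerivative_slash_invariant (k := 4) E₄.holo' (slash_E _ γ)) hlim z
  simp only [serreDerivative_apply] at h
  push_cast at h
  linear_combination h

/-- The Ramanujan identity for `E₆`. -/
theorem normalizedDeriv_E₆ (z : ℍ) : D E₆ z = (E2 z * E₆ z - E₄ z ^ 2) / 2 := by
  have hrank : Module.rank ℂ (ModularForm 𝒮ℒ ((8 : ℕ) : ℤ)) = 1 := by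
    rw [dimension_level_one 8 ⟨4, rfl⟩]
    norm_num [Nat.ModEq]
  have h4 := tendsto_E_atImInfty (k := 4) (by norm_num) ⟨2, rfl⟩
  have hD := tendsto_normalizedDeriv_atImInfty E₆.holo' (tendsto_E_atImInfty _ ⟨3, rfl⟩)
  have hlim : Tendsto (serreDerivative (6 : ℤ) E₆) atImInfty (𝓝 (0 - (6 : ℤ) * 12⁻¹ * 1 * 1)) :=
    hD.sub ((tendsto_E2_atImInfty.const_mul _).mul (tendsto_E_atImInfty _ ⟨3, rfl⟩))
  have h := eq_mul_E_of_tendsto (k := 8) (by norm_num) ⟨4, rfl⟩ hrank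
    (serreDerivative (6 : ℤ) E₆) (serreDerivative_mdifferentiable _ E₆.holo')
    (fun γ ↦ serreDerivative_slash_invariant (k := 6) E₆.holo' (slash_E _ γ)) hlim z
  -- `E₄²` and `E₈` are forms of weight 8 with the same constant term
  have h' := eq_mul_E_of_tendsto (k := 8) (by norm_num) ⟨4, rfl⟩ hrank
    (E₄ * E₄ : ℍ → ℂ) (E₄.holo'.mul E₄.holo') (fun γ ↦ by
      have := mul_slash_SL2 4 4 γ E₄ E₄
      have hE := slash_E (k := 4) (by norm_num) γ
      exact this.trans (congrArg₂ (· * ·) hE hE)) (h4.mul h4) z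
  simp only [serreDerivative_apply, Pi.mul_apply] at h h'
  push_cast at h
  linear_combination h + h' / 2

/-- `D E₂ - E₂² / 12` transforms like a modular form of weight 4: the correction terms of `D E₂`
and of `E₂²` cancel. -/
lemma slash_normalizedDeriv_E2_sub (γ : SL(2, ℤ)) :
    (fun z ↦ D E2 z - E2 z ^ 2 / 12) ∣[(4 : ℤ)] γ = fun z ↦ D E2 z - E2 z ^ 2 / 12 := by
  ext z
  have h1 := congrFun (normalizedDerivOfComplex_SL_slash (k := 2) E2_mdifferentiable (γ := γ)) z
  have hpi : (Real.pi : ℂ) ≠ 0 := ofReal_ne_zero.mpr Real.pi_ne_zero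
  have hden := denom_ne_zero γ z
  -- the defect of `E₂`, and its derivative
  have h2 : ∀ w : ℍ, (E2 ∣[(2 : ℤ)] γ) w =
      E2 w + 12 * ((2 * Real.pi * I)⁻¹ * (γ 1 0 / denom γ w)) := by
    intro w
    have := congrFun (E2_slash_action γ) w
    simp only [Pi.sub_apply, Pi.smul_apply, D2, riemannZeta_two, smul_eq_mul] at this
    rw [this]
    field_simp
    linear_combination (-(12 : ℂ) * γ 1 0) * I_sq
  have h3 : D (E2 ∣[(2 : ℤ)] γ) z =
      D E2 z - 12 * ((2 * Real.pi * I)⁻¹ * (γ 1 0 / denom γ z)) ^ 2 := by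
    have hd : HasDerivAt (fun w : ℂ ↦ (2 * Real.pi * I)⁻¹ * (γ 1 0 * denom γ w ^ (-1 : ℤ)))
        ((2 * Real.pi * I)⁻¹ * (γ 1 0 * ((-1 : ℤ) * γ 1 0 * denom γ z ^ ((-1 : ℤ) - 1)))) z := by
      simpa using ((hasDerivAt_denom_zpow γ (-1) z).const_mul (γ 1 0 : ℂ)).const_mul
        (2 * Real.pi * I)⁻¹
    have hE := (UpperHalfPlane.mdifferentiableAt_iff.mp (E2_mdifferentiable z)).hasDerivAt
    have heq : (E2 ∣[(2 : ℤ)] γ) ∘ ofComplex =ᶠ[𝓝 (z : ℂ)] fun w ↦ (E2 ∘ ofComplex) w +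
        12 * ((2 * Real.pi * I)⁻¹ * (γ 1 0 * denom γ w ^ (-1 : ℤ))) := by
      filter_upwards [isOpen_upperHalfPlaneSet.mem_nhds z.im_pos] with w hw
      simp only [Function.comp_apply, h2, ofComplex_apply_of_im_pos hw, zpow_neg_one]
      rw [div_eq_mul_inv]
    simp only [normalizedDerivOfComplex]
    rw [((hE.add (hd.const_mul 12)).congr_of_eventuallyEq heq).deriv]
    simp only [zpow_neg, zpow_sub₀ hden, zpow_one]
    field_simp
    ring
  simp only [Pi.sub_apply] at h1
  rw [h3, h2] at h1
  have h4 : (E2 ∣[(2 : ℤ)] γ) z ^ 2 = E2 (γ • z) ^ 2 * denom γ z ^ (-4 : ℤ) := by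
    rw [SL_slash_apply, mul_pow, ← zpow_natCast (denom γ z ^ (-2 : ℤ)) 2, ← zpow_mul]
    norm_num
  rw [h2] at h4
  rw [SL_slash_apply] at h1 ⊢
  push_cast at h1
  norm_num at h1 h4 ⊢
  linear_combination -h1 + h4 / 12

/-- The Ramanujan identity for `E₂`. -/
theorem normalizedDeriv_E2 (z : ℍ) : D E2 z = (E2 z ^ 2 - E₄ z) / 12 := by
  have hD := tendsto_normalizedDeriv_atImInfty E2_mdifferentiable tendsto_E2_atImInfty
  have hlim := hD.sub ((tendsto_E2_atImInfty.pow 2).div_const 12)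
  have hmd : MDiff (fun z : ℍ ↦ (D E2 z - E2 z ^ 2 / 12 : ℂ)) := by
    have := (normalizedDerivOfComplex_mdifferentiable E2_mdifferentiable).sub
      ((mdifferentiable_const (c := (12 : ℂ)⁻¹)).mul
        (E2_mdifferentiable.mul E2_mdifferentiable))
    convert! this using 1
    ext z
    simp only [Pi.sub_apply, Pi.mul_apply]
    ring
  have h := eq_mul_E_of_tendsto (k := 4) (by norm_num) ⟨2, rfl⟩ levelOne_weight_four_rank_one
    _ hmd slash_normalizedDeriv_E2_sub hlim z
  linear_combination h

end Ramanujan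

/-! ### Lattice invariants and Eisenstein series -/

section Lattices

open UpperHalfPlane hiding I
open Complex Topology MatrixGroups ModularForm EisensteinSeries Derivative Manifold

/-- The invariants `(g₂, g₃)` of the lattice `x (ℤ τ + ℤ)`, as a function of `(τ, x)`. The values
are meaningful only for `τ` in the upper half plane and `x ≠ 0`; the domain is `ℂ × ℂ` so that calculus
in the variables `τ` and `x` applies. -/
noncomputable def invariants (p : ℂ × ℂ) : ℂ × ℂ :=
  (4 * Real.pi ^ 4 / 3 * E₄ (ofComplex p.1) / p.2 ^ 4,
    8 * Real.pi ^ 6 / 27 * E₆ (ofComplex p.1) / p.2 ^ 6)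

lemma riemannZeta_six : riemannZeta 6 = Real.pi ^ 6 / 945 := by
  have h := riemannZeta_two_mul_nat (k := 3) (by norm_num)
  rw [show bernoulli (2 * 3) = 1 / 42 by decide +kernel] at h
  norm_num [Nat.factorial] at h
  rw [h]
  ring

/-- The lattice sums in terms of Eisenstein series. -/
lemma PeriodPair.G_eq_E (L : PeriodPair) (τ : ℍ) (h : L.ω₁ = τ * L.ω₂) {k : ℕ} (hk : 3 ≤ k) :
    L.G k = 2 * riemannZeta k * E hk τ / L.ω₂ ^ k := by
  have hsum : ∑' v : Fin 2 → ℤ, eisSummand k v τ = 2 * riemannZeta k * E hk τ := by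
    rw [tsum_eisSummand_eq_riemannZeta_mul_eisensteinSeries hk,
      show E hk τ = (1 / 2 : ℂ) • eisensteinSeriesSIF (N := 1) 0 k τ from rfl,
      eisensteinSeriesSIF_apply 0 k τ, smul_eq_mul]
    ring
  rw [PeriodPair.G, ← hsum, ← (finTwoArrowEquiv ℤ).symm.tsum_eq,
    ← L.latticeEquivProd.symm.toEquiv.tsum_eq, div_eq_mul_inv, ← tsum_mul_right]
  refine tsum_congr fun v ↦ ?_
  have := L.latticeEquiv_symm_apply v
  simp only [LinearEquiv.coe_toEquiv, this, h, eisSummand, finTwoArrowEquiv_symm_apply,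
    zpow_neg, zpow_natCast, ← mul_inv, ← mul_pow, Matrix.cons_val_zero, Matrix.cons_val_one]
  ring_nf

lemma PeriodPair.invariants_eq (L : PeriodPair) (τ : ℍ) (h : L.ω₁ = τ * L.ω₂) :
    (L.g₂, L.g₃) = invariants (τ, L.ω₂) := by
  have h4 := L.G_eq_E τ h (k := 4) (by norm_num)
  have h6 := L.G_eq_E τ h (k := 6) (by norm_num)
  push_cast at h4 h6
  rw [riemannZeta_four] at h4
  rw [riemannZeta_six] at h6
  simp only [PeriodPair.g₂, PeriodPair.g₃, h4, h6, invariants, ofComplex_apply, Prod.mk.injEq]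
  constructor <;> ring

/-- The lattice spanned by `τ x` and `x`. -/
noncomputable def PeriodPair.ofRatio (τ : ℍ) (x : ℂ) (hx : x ≠ 0) : PeriodPair where
  ω₁ := τ * x
  ω₂ := x
  indep := by
    rw [LinearIndependent.pair_iff]
    intro s t h
    simp only [real_smul] at h
    have h' : (s : ℂ) * τ + t = 0 := by
      have : ((s : ℂ) * τ + t) * x = 0 := by linear_combination h
      exact (mul_eq_zero.mp this).resolve_right hx
    have him := congrArg Complex.im h'
    have hs : s = 0 := by simpa [τ.im_ne_zero] using him
    have hre := congrArg Complex.re h'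
    exact ⟨hs, by simpa [hs] using hre⟩

lemma PeriodPair.mem_lattice_ofRatio {τ : ℍ} {x : ℂ} {hx : x ≠ 0} {z : ℂ} :
    z ∈ (PeriodPair.ofRatio τ x hx).lattice ↔ ∃ m n : ℤ, z = (m * τ + n) * x := by
  rw [PeriodPair.mem_lattice]
  refine exists₂_congr fun m n ↦ ?_
  rw [eq_comm]
  simp only [PeriodPair.ofRatio]
  ring_nf

lemma PeriodPair.invariants_ofRatio (τ : ℍ) (x : ℂ) (hx : x ≠ 0) :
    ((PeriodPair.ofRatio τ x hx).g₂, (PeriodPair.ofRatio τ x hx).g₃) = invariants (τ, x) :=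
  PeriodPair.invariants_eq _ τ rfl

lemma PeriodPair.G_congr {L L' : PeriodPair} (h : L.lattice = L'.lattice) (k : ℕ) :
    L.G k = L'.G k := by
  unfold PeriodPair.G
  rw [h]

/-- Every lattice has an oriented basis `(τ x, x)` with `τ` in the upper half plane. -/
lemma PeriodPair.exists_ofRatio (L : PeriodPair) :
    ∃ (τ : ℍ) (x : ℂ) (hx : x ≠ 0), (PeriodPair.ofRatio τ x hx).lattice = L.lattice := by
  have hind := LinearIndependent.pair_iff.mp L.indep
  have h2 : L.ω₂ ≠ 0 := fun h ↦ by simpa using hind 0 1 (by simp [h])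
  have him : (L.ω₁ / L.ω₂).im ≠ 0 := by
    intro h
    have hre : L.ω₁ / L.ω₂ = ((L.ω₁ / L.ω₂).re : ℂ) := by
      apply Complex.ext <;> simp [h]
    have := hind 1 (-(L.ω₁ / L.ω₂).re) (by
      simp only [real_smul, ofReal_neg, ← hre]
      field_simp
      simp)
    exact one_ne_zero this.1
  have hdiv : L.ω₁ = L.ω₁ / L.ω₂ * L.ω₂ := by field_simp
  rcases lt_or_gt_of_ne him with h | h
  · refine ⟨⟨-(L.ω₁ / L.ω₂), by simpa using h⟩, L.ω₂, h2, ?_⟩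
    ext z
    rw [PeriodPair.mem_lattice_ofRatio, PeriodPair.mem_lattice]
    constructor
    · rintro ⟨m, n, rfl⟩
      refine ⟨-m, n, ?_⟩
      push_cast
      change -(m : ℂ) * L.ω₁ + n * L.ω₂ = (m * -(L.ω₁ / L.ω₂) + n) * L.ω₂
      field_simp
    · rintro ⟨m, n, rfl⟩
      refine ⟨-m, n, ?_⟩
      push_cast
      change (m : ℂ) * L.ω₁ + n * L.ω₂ = (-m * -(L.ω₁ / L.ω₂) + n) * L.ω₂
      field_simp
  · refine ⟨⟨L.ω₁ / L.ω₂, h⟩, L.ω₂, h2, ?_⟩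
    have : PeriodPair.ofRatio ⟨L.ω₁ / L.ω₂, h⟩ L.ω₂ h2 = L := by
      cases L
      simp only [PeriodPair.ofRatio, PeriodPair.mk.injEq, and_true]
      exact hdiv.symm
    rw [this]

lemma hasDerivAt_E₄ (τ : ℍ) : HasDerivAt (fun z ↦ E₄ (ofComplex z))
    (2 * Real.pi * I * ((E2 τ * E₄ τ - E₆ τ) / 3)) τ := by
  have h := (UpperHalfPlane.mdifferentiableAt_iff.mp (ModularFormClass.holo E₄ τ)).hasDerivAt
  rwa [show deriv ((E₄ : ℍ → ℂ) ∘ ofComplex) τ = 2 * Real.pi * I * D E₄ τ by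
    rw [normalizedDerivOfComplex, mul_inv_cancel_left₀ two_pi_I_ne_zero], normalizedDeriv_E₄] at h

lemma hasDerivAt_E₆ (τ : ℍ) : HasDerivAt (fun z ↦ E₆ (ofComplex z))
    (2 * Real.pi * I * ((E2 τ * E₆ τ - E₄ τ ^ 2) / 2)) τ := by
  have h := (UpperHalfPlane.mdifferentiableAt_iff.mp (ModularFormClass.holo E₆ τ)).hasDerivAt
  rwa [show deriv ((E₆ : ℍ → ℂ) ∘ ofComplex) τ = 2 * Real.pi * I * D E₆ τ by
    rw [normalizedDerivOfComplex, mul_inv_cancel_left₀ two_pi_I_ne_zero], normalizedDeriv_E₆] at h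

lemma hasDerivAt_E2 (τ : ℍ) : HasDerivAt (fun z ↦ E2 (ofComplex z))
    (2 * Real.pi * I * ((E2 τ ^ 2 - E₄ τ) / 12)) τ := by
  have h := (UpperHalfPlane.mdifferentiableAt_iff.mp (E2_mdifferentiable τ)).hasDerivAt
  rwa [show deriv ((E2 : ℍ → ℂ) ∘ ofComplex) τ = 2 * Real.pi * I * D E2 τ by
    rw [normalizedDerivOfComplex, mul_inv_cancel_left₀ two_pi_I_ne_zero], normalizedDeriv_E2] at h

end Lattices

/-! ### The lattice invariants as local coordinates -/

section LocalPeriods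

open UpperHalfPlane hiding I
open Complex Topology MatrixGroups ModularForm EisensteinSeries Derivative Manifold

lemma E₄_cube_sub_E₆_sq_ne_zero (τ : ℍ) : E₄ τ ^ 3 - E₆ τ ^ 2 ≠ 0 := by
  have h := discriminant_eq_E₄_cube_sub_E₆_sq τ
  intro h0
  rw [h0, zero_div] at h
  exact discriminant_ne_zero τ h

/-- The linear map `(u, v) ↦ (a u + b v, c u + d v)`. -/
noncomputable def linearMapOfEntries (a b c d : ℂ) : ℂ × ℂ →L[ℂ] ℂ × ℂ :=
  (a • ContinuousLinearMap.fst ℂ ℂ ℂ + b • ContinuousLinearMap.snd ℂ ℂ ℂ).prod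
    (c • ContinuousLinearMap.fst ℂ ℂ ℂ + d • ContinuousLinearMap.snd ℂ ℂ ℂ)

lemma exists_equiv_of_det_ne_zero {a b c d : ℂ} (h : a * d - b * c ≠ 0) :
    ∃ e : (ℂ × ℂ) ≃L[ℂ] ℂ × ℂ, (e : ℂ × ℂ →L[ℂ] ℂ × ℂ) = linearMapOfEntries a b c d := by
  have hinj : Function.Injective (linearMapOfEntries a b c d : ℂ × ℂ →ₗ[ℂ] ℂ × ℂ) := by
    rw [injective_iff_map_eq_zero]
    rintro ⟨u, v⟩ huv
    simp only [linearMapOfEntries, ContinuousLinearMap.coe_coe, ContinuousLinearMap.prod_apply,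
      add_apply, smul_apply, ContinuousLinearMap.coe_fst',
      ContinuousLinearMap.coe_snd', smul_eq_mul, Prod.mk_eq_zero] at huv ⊢
    obtain ⟨h1, h2⟩ := huv
    exact ⟨(mul_eq_zero.mp (by linear_combination d * h1 - b * h2 :
        (a * d - b * c) * u = 0)).resolve_left h,
      (mul_eq_zero.mp (by linear_combination a * h2 - c * h1 :
        (a * d - b * c) * v = 0)).resolve_left h⟩
  refine ⟨(LinearEquiv.ofInjectiveEndo _ hinj).toContinuousLinearEquiv, ?_⟩
  ext <;> rfl

lemma analyticAt_comp_ofComplex {f : ℍ → ℂ} (hf : MDiff f) (τ : ℍ) :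
    AnalyticAt ℂ (fun z ↦ f (ofComplex z)) τ :=
  (UpperHalfPlane.mdifferentiable_iff.mp hf).analyticAt
    (isOpen_upperHalfPlaneSet.mem_nhds τ.im_pos)

lemma analyticAt_invariants (τ : ℍ) {x : ℂ} (hx : x ≠ 0) :
    AnalyticAt ℂ invariants ((τ : ℂ), x) := by
  have h4 : AnalyticAt ℂ (fun p : ℂ × ℂ ↦ E₄ (ofComplex p.1)) ((τ : ℂ), x) :=
    (analyticAt_comp_ofComplex (ModularFormClass.holo E₄) τ).comp_of_eq analyticAt_fst rfl
  have h6 : AnalyticAt ℂ (fun p : ℂ × ℂ ↦ E₆ (ofComplex p.1)) ((τ : ℂ), x) :=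
    (analyticAt_comp_ofComplex (ModularFormClass.holo E₆) τ).comp_of_eq analyticAt_fst rfl
  exact ((analyticAt_const.mul h4).div (analyticAt_snd.pow 4) (pow_ne_zero 4 hx)).prod
    ((analyticAt_const.mul h6).div (analyticAt_snd.pow 6) (pow_ne_zero 6 hx))

lemma hasFDerivAt_invariants (τ : ℍ) {x : ℂ} (hx : x ≠ 0) :
    HasFDerivAt invariants (linearMapOfEntries
      (4 * Real.pi ^ 4 / 3 * (2 * Real.pi * I * ((E2 τ * E₄ τ - E₆ τ) / 3)) / x ^ 4)
      (4 * Real.pi ^ 4 / 3 * E₄ τ * (-4 / x ^ 5))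
      (8 * Real.pi ^ 6 / 27 * (2 * Real.pi * I * ((E2 τ * E₆ τ - E₄ τ ^ 2) / 2)) / x ^ 6)
      (8 * Real.pi ^ 6 / 27 * E₆ τ * (-6 / x ^ 7))) ((τ : ℂ), x) := by
  have key : ∀ (f : ℂ → ℂ) (f' : ℂ) (c : ℂ) (n : ℕ), 0 < n → HasDerivAt f f' τ →
      HasFDerivAt (fun p : ℂ × ℂ ↦ c * f p.1 / p.2 ^ n)
        ((c * f' / x ^ n) • ContinuousLinearMap.fst ℂ ℂ ℂ +
          (c * f τ * (-n / x ^ (n + 1))) • ContinuousLinearMap.snd ℂ ℂ ℂ) ((τ : ℂ), x) := by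
    intro f f' c n hn hf
    have h1 : HasFDerivAt (fun p : ℂ × ℂ ↦ f p.1) (f' • ContinuousLinearMap.fst ℂ ℂ ℂ)
        ((τ : ℂ), x) :=
      HasDerivAt.comp_hasFDerivAt (f := Prod.fst) ((τ : ℂ), x) hf hasFDerivAt_fst
    have h2 : HasDerivAt (fun z : ℂ ↦ (z ^ n)⁻¹) (-n / x ^ (n + 1)) x := by
      convert! (hasDerivAt_pow n x).inv (pow_ne_zero n hx) using 1
      obtain ⟨m, rfl⟩ := Nat.exists_eq_succ_of_ne_zero hn.ne'
      simp only [Nat.succ_eq_add_one, Nat.add_sub_cancel]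
      field_simp
      ring
    have h3 : HasFDerivAt (fun p : ℂ × ℂ ↦ (p.2 ^ n)⁻¹)
        ((-n / x ^ (n + 1) : ℂ) • ContinuousLinearMap.snd ℂ ℂ ℂ) ((τ : ℂ), x) :=
      HasDerivAt.comp_hasFDerivAt (f := Prod.snd) ((τ : ℂ), x) h2 hasFDerivAt_snd
    convert! (h1.const_mul c).mul h3 using 1
    ext <;> simp
    ring
  have h := (key _ _ (4 * Real.pi ^ 4 / 3) 4 (by norm_num) (hasDerivAt_E₄ τ)).prodMk
    (key _ _ (8 * Real.pi ^ 6 / 27) 6 (by norm_num) (hasDerivAt_E₆ τ))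
  simpa only [ofComplex_apply] using! h

/-- The lattice invariants are local coordinates on the space of oriented lattice bases: the
Jacobian determinant is, by the Ramanujan identities, a nonzero multiple of `E₄³ - E₆²`. -/
lemma exists_local_inverse_invariants (τ : ℍ) {x : ℂ} (hx : x ≠ 0) :
    ∃ S : ℂ × ℂ → ℂ × ℂ, AnalyticAt ℂ S (invariants (τ, x)) ∧
      S (invariants (τ, x)) = (↑τ, x) ∧
      (∀ᶠ q in 𝓝 (invariants (τ, x)), invariants (S q) = q) ∧
      ∀ᶠ p in 𝓝 ((τ : ℂ), x), S (invariants p) = p := by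
  have hpi : (Real.pi : ℂ) ≠ 0 := ofReal_ne_zero.mpr Real.pi_ne_zero
  have hF := hasFDerivAt_invariants τ hx
  obtain ⟨e, he⟩ := exists_equiv_of_det_ne_zero
    (a := 4 * Real.pi ^ 4 / 3 * (2 * Real.pi * I * ((E2 τ * E₄ τ - E₆ τ) / 3)) / x ^ 4)
    (b := 4 * Real.pi ^ 4 / 3 * E₄ τ * (-4 / x ^ 5))
    (c := 8 * Real.pi ^ 6 / 27 * (2 * Real.pi * I * ((E2 τ * E₆ τ - E₄ τ ^ 2) / 2)) / x ^ 6)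
    (d := 8 * Real.pi ^ 6 / 27 * E₆ τ * (-6 / x ^ 7)) (by
      have h : -(128 * Real.pi ^ 11 * I / 81) / x ^ 11 * (E₄ τ ^ 3 - E₆ τ ^ 2) ≠ 0 :=
        mul_ne_zero (div_ne_zero (by simp [hpi]) (pow_ne_zero _ hx)) (E₄_cube_sub_E₆_sq_ne_zero τ)
      convert! h using 1
      field_simp
      ring)
  rw [← he] at hF
  have hS : HasStrictFDerivAt invariants (e : ℂ × ℂ →L[ℂ] ℂ × ℂ) ((τ : ℂ), x) := by
    have := (analyticAt_invariants τ hx).hasStrictFDerivAt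
    rwa [hF.fderiv] at this
  have hC : ContDiffAt ℂ ⊤ invariants ((τ : ℂ), x) := (analyticAt_invariants τ hx).contDiffAt
  exact ⟨hS.localInverse, (hC.to_localInverse hF (by simp)).analyticAt, hS.localInverse_apply_image,
    hS.eventually_right_inverse, hS.eventually_left_inverse⟩

end LocalPeriods

/-! ### The Gauss–Manin system -/

section GaussManin

open UpperHalfPlane hiding I
open Complex Topology MatrixGroups ModularForm EisensteinSeries Derivative Manifold

namespace EllipticPencil

variable {U : Set ℂ}

/-- The discriminant `Δ = g₂³ - 27 g₃²`. -/
noncomputable def disc (E : EllipticPencil U) (t : ℂ) : ℂ := E.g₂ t ^ 3 - 27 * E.g₃ t ^ 2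

/-- The diagonal entry `Δ' / (12 Δ)` of the Gauss–Manin connection. -/
noncomputable def gmDiag (E : EllipticPencil U) (t : ℂ) : ℂ := deriv E.disc t / (12 * E.disc t)

/-- The off-diagonal entry `(3 g₃ g₂' - 2 g₂ g₃') / (2 Δ)` of the Gauss–Manin connection. -/
noncomputable def gmOff (E : EllipticPencil U) (t : ℂ) : ℂ :=
  (3 * E.g₃ t * deriv E.g₂ t - 2 * E.g₂ t * deriv E.g₃ t) / (2 * E.disc t)

/-- The Picard–Fuchs operator of the pencil, multiplied by the entry `gmOff` of the Gauss–Manin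
connection in order to clear denominators, applied to a function. -/
noncomputable def clearedPicardFuchs (E : EllipticPencil U) (f : ℂ → ℂ) (t : ℂ) : ℂ :=
  E.gmOff t * deriv (deriv f) t - deriv E.gmOff t * deriv f t +
    (E.gmOff t * deriv E.gmDiag t - E.gmDiag t * deriv E.gmOff t - E.gmOff t * E.gmDiag t ^ 2 +
      3 / 4 * E.g₂ t * E.gmOff t ^ 3) * f t

lemma analyticAt_disc (E : EllipticPencil U) {t : ℂ} (ht : t ∈ U) : AnalyticAt ℂ E.disc t :=
  ((E.analytic_g₂ t ht).pow 3).sub (analyticAt_const.mul ((E.analytic_g₃ t ht).pow 2))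

lemma analyticAt_gmDiag (E : EllipticPencil U) {t : ℂ} (ht : t ∈ U) : AnalyticAt ℂ E.gmDiag t :=
  (E.analyticAt_disc ht).deriv.div (analyticAt_const.mul (E.analyticAt_disc ht))
    (mul_ne_zero (by norm_num) (E.disc_ne_zero t ht))

lemma analyticAt_gmOff (E : EllipticPencil U) {t : ℂ} (ht : t ∈ U) : AnalyticAt ℂ E.gmOff t :=
  (((analyticAt_const.mul (E.analytic_g₃ t ht)).mul (E.analytic_g₂ t ht).deriv).sub
    ((analyticAt_const.mul (E.analytic_g₂ t ht)).mul (E.analytic_g₃ t ht).deriv)).div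
    (analyticAt_const.mul (E.analyticAt_disc ht))
    (mul_ne_zero (by norm_num) (E.disc_ne_zero t ht))

/-- The holomorphic functions `τ x`, `x` near `t₀` form an oriented basis of the period lattice. -/
structure IsPeriodFrameAt (E : EllipticPencil U) (τ x : ℂ → ℂ) (t₀ : ℂ) : Prop where
  analytic_ratio : AnalyticAt ℂ τ t₀
  analytic_period : AnalyticAt ℂ x t₀
  im_pos : 0 < (τ t₀).im
  ne_zero : x t₀ ≠ 0
  invariants_eq : ∀ᶠ t in 𝓝 t₀, invariants (τ t, x t) = (E.g₂ t, E.g₃ t)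

lemma IsPeriodFrameAt.eventually {E : EllipticPencil U} {τ x : ℂ → ℂ} {t₀ : ℂ}
    (h : E.IsPeriodFrameAt τ x t₀) : ∀ᶠ t in 𝓝 t₀, E.IsPeriodFrameAt τ x t := by
  filter_upwards [h.analytic_ratio.eventually_analyticAt, h.analytic_period.eventually_analyticAt,
    h.analytic_ratio.continuousAt.eventually
      ((isOpen_lt continuous_const Complex.continuous_im).mem_nhds h.im_pos),
    h.analytic_period.continuousAt.eventually_ne h.ne_zero,
    h.invariants_eq.eventually_nhds] with t h1 h2 h3 h4 h5
  exact ⟨h1, h2, h3, h4, h5⟩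

/-- An oriented basis of the lattice of one fibre extends uniquely to a holomorphic family of such
bases of the lattices of the neighbouring fibres. -/
lemma exists_isPeriodFrameAt (E : EllipticPencil U) {t₀ : ℂ} (ht₀ : t₀ ∈ U) (τ₀ : ℍ) {x₀ : ℂ}
    (hx₀ : x₀ ≠ 0) (h : invariants (τ₀, x₀) = (E.g₂ t₀, E.g₃ t₀)) :
    ∃ τ x : ℂ → ℂ, E.IsPeriodFrameAt τ x t₀ ∧ τ t₀ = τ₀ ∧ x t₀ = x₀ ∧
      ∀ᶠ p in 𝓝 ((τ₀ : ℂ), x₀), ∀ t, invariants p = (E.g₂ t, E.g₃ t) → p = (τ t, x t) := by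
  obtain ⟨S, hS, hS0, hSr, hSl⟩ := exists_local_inverse_invariants τ₀ hx₀
  have hg : AnalyticAt ℂ (fun t ↦ (E.g₂ t, E.g₃ t)) t₀ :=
    (E.analytic_g₂ t₀ ht₀).prod (E.analytic_g₃ t₀ ht₀)
  rw [h] at hS hS0 hSr
  have hSg : AnalyticAt ℂ (fun t ↦ S (E.g₂ t, E.g₃ t)) t₀ := hS.comp_of_eq hg rfl
  refine ⟨fun t ↦ (S (E.g₂ t, E.g₃ t)).1, fun t ↦ (S (E.g₂ t, E.g₃ t)).2,
    ⟨analyticAt_fst.comp hSg, analyticAt_snd.comp hSg, ?_, ?_, ?_⟩, ?_, ?_, ?_⟩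
  · simpa [hS0] using τ₀.im_pos
  · simpa [hS0] using hx₀
  · exact hg.continuousAt.eventually hSr
  · simp [hS0]
  · simp [hS0]
  · filter_upwards [hSl] with p hp t ht
    rw [← ht, hp]

/-- The derivatives of the coefficients of the pencil in terms of a period frame. -/
lemma IsPeriodFrameAt.deriv_coeffs {E : EllipticPencil U} {τ x : ℂ → ℂ} {t : ℂ}
    (h : E.IsPeriodFrameAt τ x t) :
    deriv E.g₂ t = 4 * (E2 (ofComplex (τ t)) * (2 * Real.pi * I * deriv τ t) / 12 -
        deriv x t / x t) * E.g₂ t -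
      18 * (2 * Real.pi * I * deriv τ t * x t ^ 2 / (12 * Real.pi ^ 2)) * E.g₃ t ∧
    deriv E.g₃ t = 6 * (E2 (ofComplex (τ t)) * (2 * Real.pi * I * deriv τ t) / 12 -
        deriv x t / x t) * E.g₃ t -
      (2 * Real.pi * I * deriv τ t * x t ^ 2 / (12 * Real.pi ^ 2)) * E.g₂ t ^ 2 := by
  have hpi : (Real.pi : ℂ) ≠ 0 := ofReal_ne_zero.mpr Real.pi_ne_zero
  have hx := h.ne_zero
  have hval := h.invariants_eq.self_of_nhds
  simp only [invariants, Prod.mk.injEq] at hval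
  have hτ := h.analytic_ratio.differentiableAt.hasDerivAt
  have hxd := h.analytic_period.differentiableAt.hasDerivAt
  set z : ℍ := ⟨τ t, h.im_pos⟩ with hz
  have hzτ : ofComplex (τ t) = z := ofComplex_apply_of_im_pos h.im_pos
  have h4 : HasDerivAt (fun s ↦ E₄ (ofComplex (τ s)))
      (2 * Real.pi * I * ((E2 z * E₄ z - E₆ z) / 3) * deriv τ t) t :=
    (hasDerivAt_E₄ z).comp t hτ
  have h6 : HasDerivAt (fun s ↦ E₆ (ofComplex (τ s)))
      (2 * Real.pi * I * ((E2 z * E₆ z - E₄ z ^ 2) / 2) * deriv τ t) t :=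
    (hasDerivAt_E₆ z).comp t hτ
  have hg2 : E.g₂ =ᶠ[𝓝 t] fun s ↦ 4 * Real.pi ^ 4 / 3 * E₄ (ofComplex (τ s)) / x s ^ 4 := by
    filter_upwards [h.invariants_eq] with s hs
    exact (congrArg Prod.fst hs).symm
  have hg3 : E.g₃ =ᶠ[𝓝 t] fun s ↦ 8 * Real.pi ^ 6 / 27 * E₆ (ofComplex (τ s)) / x s ^ 6 := by
    filter_upwards [h.invariants_eq] with s hs
    exact (congrArg Prod.snd hs).symm
  rw [hzτ] at hval ⊢
  rw [← hval.1, ← hval.2,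
    (((h4.const_mul _).fun_div (hxd.fun_pow 4) (pow_ne_zero 4 hx)).congr_of_eventuallyEq hg2).deriv,
    (((h6.const_mul _).fun_div (hxd.fun_pow 6) (pow_ne_zero 6 hx)).congr_of_eventuallyEq hg3).deriv,
    hzτ]
  constructor <;> field_simp <;> ring

/-- The Gauss–Manin connection in terms of a period frame. -/
lemma IsPeriodFrameAt.gm_eq {E : EllipticPencil U} {τ x : ℂ → ℂ} {t : ℂ}
    (h : E.IsPeriodFrameAt τ x t) (ht : t ∈ U) :
    E.gmDiag t = E2 (ofComplex (τ t)) * (2 * Real.pi * I * deriv τ t) / 12 - deriv x t / x t ∧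
      E.gmOff t = 2 * Real.pi * I * deriv τ t * x t ^ 2 / (12 * Real.pi ^ 2) := by
  obtain ⟨h2, h3⟩ := h.deriv_coeffs
  have hd := E.disc_ne_zero t ht
  have hdisc : deriv E.disc t = 3 * E.g₂ t ^ 2 * deriv E.g₂ t - 54 * E.g₃ t * deriv E.g₃ t := by
    have h2' := (E.analytic_g₂ t ht).differentiableAt.hasDerivAt
    have h3' := (E.analytic_g₃ t ht).differentiableAt.hasDerivAt
    refine ((h2'.fun_pow 3).sub ((h3'.fun_pow 2).const_mul 27)).deriv.trans ?_
    norm_num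
    ring
  set P := E2 (ofComplex (τ t)) * (2 * Real.pi * I * deriv τ t) / 12 - deriv x t / x t
  set w := 2 * Real.pi * I * deriv τ t * x t ^ 2 / (12 * Real.pi ^ 2)
  rw [gmDiag, gmOff, hdisc, h2, h3, disc, div_eq_iff (mul_ne_zero (by norm_num) hd),
    div_eq_iff (mul_ne_zero (by norm_num) hd)]
  constructor <;> ring

/-- A period `x` and its quasi-period `π² E₂(τ) / x` satisfy the Gauss–Manin system. -/
lemma IsPeriodFrameAt.hasDerivAt {E : EllipticPencil U} {τ x : ℂ → ℂ} {t : ℂ}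
    (h : E.IsPeriodFrameAt τ x t) (ht : t ∈ U) :
    HasDerivAt τ (-6 * Real.pi * I * E.gmOff t / x t ^ 2) t ∧
    HasDerivAt x (-E.gmDiag t * x t +
      E.gmOff t * (Real.pi ^ 2 * E2 (ofComplex (τ t)) / x t)) t ∧
    HasDerivAt (fun s ↦ Real.pi ^ 2 * E2 (ofComplex (τ s)) / x s)
      (E.gmDiag t * (Real.pi ^ 2 * E2 (ofComplex (τ t)) / x t) -
        3 / 4 * E.g₂ t * E.gmOff t * x t) t := by
  have hpi : (Real.pi : ℂ) ≠ 0 := ofReal_ne_zero.mpr Real.pi_ne_zero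
  have hx := h.ne_zero
  obtain ⟨hP, hw⟩ := h.gm_eq ht
  have hval := congrArg Prod.fst h.invariants_eq.self_of_nhds
  simp only [invariants] at hval
  have hτ := h.analytic_ratio.differentiableAt.hasDerivAt
  have hxd := h.analytic_period.differentiableAt.hasDerivAt
  have hzτ : ofComplex (τ t) = ⟨τ t, h.im_pos⟩ := ofComplex_apply_of_im_pos h.im_pos
  have h2 : HasDerivAt (fun s ↦ E2 (ofComplex (τ s))) _ t :=
    (hasDerivAt_E2 ⟨τ t, h.im_pos⟩).comp t hτ
  rw [← hzτ] at h2
  refine ⟨?_, ?_, ?_⟩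
  · convert! hτ using 1
    rw [hw]
    field_simp
    linear_combination (-12 * deriv τ t) * I_sq
  · convert! hxd using 1
    rw [hw, hP]
    field_simp
    ring
  · convert! (h2.const_mul (Real.pi ^ 2 : ℂ)).fun_div hxd hx using 1
    rw [hw, hP, ← hval]
    field_simp
    ring

/-- Linear combinations of the periods in a frame satisfy the Picard–Fuchs equation. -/
lemma IsPeriodFrameAt.clearedPicardFuchs_eq_zero {E : EllipticPencil U} {τ x : ℂ → ℂ} {t₀ : ℂ}
    (h : E.IsPeriodFrameAt τ x t₀) (hU : IsOpen U) (ht₀ : t₀ ∈ U) (m n : ℂ) :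
    ∀ᶠ t in 𝓝 t₀, E.clearedPicardFuchs (fun s ↦ (m * τ s + n) * x s) t = 0 := by
  set f : ℂ → ℂ := fun s ↦ (m * τ s + n) * x s
  -- the quasi-period belonging to `f`; the last term is the contribution of `τ'` to `f'`
  set φ : ℂ → ℂ := fun s ↦ (m * τ s + n) * (Real.pi ^ 2 * E2 (ofComplex (τ s)) / x s) -
    m * (6 * Real.pi * I) / x s
  have hsys : ∀ᶠ t in 𝓝 t₀, HasDerivAt f (-E.gmDiag t * f t + E.gmOff t * φ t) t ∧
      HasDerivAt φ (E.gmDiag t * φ t - 3 / 4 * E.g₂ t * E.gmOff t * f t) t := by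
    filter_upwards [h.eventually, hU.mem_nhds ht₀] with t ht htU
    obtain ⟨h1, h2, h3⟩ := ht.hasDerivAt htU
    have hx := ht.ne_zero
    constructor
    · convert! ((h1.const_mul m).add_const n).fun_mul h2 using 1
      simp only [f, φ]
      field_simp
      ring
    · convert! (((h1.const_mul m).add_const n).fun_mul h3).fun_sub
        ((hasDerivAt_const t (m * (6 * Real.pi * I))).fun_div h2 hx) using 1
      simp only [f, φ]
      field_simp
      ring
  -- eliminating `φ` from the first order system gives the second order equation for `f`
  filter_upwards [hsys.eventually_nhds, hU.mem_nhds ht₀] with t ht htU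
  have hP := (E.analyticAt_gmDiag htU).differentiableAt.hasDerivAt
  have hw := (E.analyticAt_gmOff htU).differentiableAt.hasDerivAt
  obtain ⟨hf, hφ⟩ := ht.self_of_nhds
  have hf' : deriv f =ᶠ[𝓝 t] fun s ↦ -E.gmDiag s * f s + E.gmOff s * φ s := by
    filter_upwards [ht] with s hs
    exact hs.1.deriv
  have hf'' := (((hP.fun_neg.fun_mul hf).fun_add (hw.fun_mul hφ)).congr_of_eventuallyEq hf').deriv
  rw [clearedPicardFuchs, hf'', hf.deriv]
  ring

end EllipticPencil

end GaussManin

/-! ### The Picard–Fuchs operator -/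

section PicardFuchs

open UpperHalfPlane hiding I
open Complex Topology

/-- A function on an uncountable set with values in a second countable space returns arbitrarily
close to one of its values at arguments arbitrarily close to the corresponding point: an
uncountable graph cannot be discrete. -/
lemma exists_frequently_mem_of_not_countable {X Y : Type*} [TopologicalSpace X]
    [TopologicalSpace Y] [SecondCountableTopology X] [SecondCountableTopology Y] {B : Set X}
    (hB : ¬ B.Countable) (F : X → Y) :
    ∃ t₀ ∈ B, ∀ V ∈ 𝓝 (F t₀), ∃ᶠ t in 𝓝[≠] t₀, t ∈ B ∧ F t ∈ V := by
  by_contra! h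
  refine hB ?_
  have hbasis : ∀ t₀ ∈ B, ∃ W ∈ TopologicalSpace.countableBasis (X × Y), (t₀, F t₀) ∈ W ∧
      ∀ t ∈ B, (t, F t) ∈ W → t = t₀ := by
    intro t₀ ht₀
    obtain ⟨V, hV, hfreq⟩ := h t₀ ht₀
    rw [eventually_nhdsWithin_iff] at hfreq
    have hmem : {t | t ∈ ({t₀}ᶜ : Set X) → t ∈ B → F t ∉ V} ×ˢ V ∈ 𝓝 (t₀, F t₀) :=
      prod_mem_nhds hfreq hV
    obtain ⟨W, hW, hW0, hWs⟩ :=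
      (TopologicalSpace.isBasis_countableBasis (X × Y)).mem_nhds_iff.mp hmem
    refine ⟨W, hW, hW0, fun t htB ht ↦ ?_⟩
    by_contra hne
    exact (hWs ht).1 hne htB (hWs ht).2
  choose! W hW hW0 hWu using hbasis
  refine Set.MapsTo.countable_of_injOn (f := W) hW ?_
    (TopologicalSpace.countable_countableBasis (X × Y))
  intro s hs t ht hst
  exact hWu t ht s hs (hst ▸ hW0 s hs)

lemma not_countable_of_isOpen {B : Set ℂ} (hB : IsOpen B) (hne : B.Nonempty) : ¬ B.Countable :=
  fun h ↦ (hB.measure_pos MeasureTheory.volume hne).ne' (h.measure_zero _)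

namespace EllipticPencil

variable {U : Set ℂ}

/-- Every lattice of a fibre has an oriented basis. -/
lemma IsPeriodPairAt.exists_basis {E : EllipticPencil U} {t : ℂ} {L : PeriodPair}
    (h : E.IsPeriodPairAt t L) : ∃ (τ : ℍ) (x : ℂ), x ≠ 0 ∧
      invariants (τ, x) = (E.g₂ t, E.g₃ t) ∧
      ∀ z, z ∈ L.lattice ↔ ∃ m n : ℤ, z = (m * τ + n) * x := by
  obtain ⟨τ, x, hx, hL⟩ := L.exists_ofRatio
  refine ⟨τ, x, hx, ?_, fun z ↦ ?_⟩
  · rw [← PeriodPair.invariants_ofRatio τ x hx, ← h.1, ← h.2]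
    simp only [PeriodPair.g₂, PeriodPair.g₃, PeriodPair.G_congr hL]
  · rw [← hL, PeriodPair.mem_lattice_ofRatio]

lemma analyticAt_clearedPicardFuchs (E : EllipticPencil U) {f : ℂ → ℂ} {t : ℂ} (ht : t ∈ U)
    (hf : AnalyticAt ℂ f t) : AnalyticAt ℂ (E.clearedPicardFuchs f) t := by
  have hw := E.analyticAt_gmOff ht
  have hP := E.analyticAt_gmDiag ht
  have hg := E.analytic_g₂ t ht
  unfold clearedPicardFuchs
  fun_prop

lemma clearedPicardFuchs_congr (E : EllipticPencil U) {f g : ℂ → ℂ} {t : ℂ} (h : f =ᶠ[𝓝 t] g) :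
    E.clearedPicardFuchs f t = E.clearedPicardFuchs g t := by
  rw [clearedPicardFuchs, clearedPicardFuchs, h.deriv.deriv_eq, h.deriv_eq, h.self_of_nhds]

/-- A period function has values in the lattice spanned by a period frame along a sequence with a
limit, with constant integral coefficients, so it is an integral combination of the frame. -/
lemma IsPeriodFunctionOn.exists_clearedPicardFuchs_eq_zero {E : EllipticPencil U} {f : ℂ → ℂ}
    {V : Set ℂ} (hf : E.IsPeriodFunctionOn f V) (hU : IsOpen U) (hVU : V ⊆ U) {B : Set ℂ}
    (hB : IsOpen B) (hne : B.Nonempty) (hBV : B ⊆ V) : ∃ t ∈ B, E.clearedPicardFuchs f t = 0 := by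
  have hchoice : ∀ t ∈ B, ∃ (τ : ℍ) (x : ℂ) (m n : ℤ), x ≠ 0 ∧
      invariants (τ, x) = (E.g₂ t, E.g₃ t) ∧ f t = (m * τ + n) * x := by
    intro t ht
    obtain ⟨L, hL, hfL⟩ := hf.2 t (hBV ht)
    obtain ⟨τ, x, hx, hinv, hmem⟩ := hL.exists_basis
    obtain ⟨m, n, hmn⟩ := (hmem _).mp hfL
    exact ⟨τ, x, m, n, hx, hinv, hmn⟩
  choose! τ x m n hx hinv hmn using hchoice
  obtain ⟨t₀, ht₀, hacc⟩ := exists_frequently_mem_of_not_countable (not_countable_of_isOpen hB hne)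
    (fun t ↦ (((τ t : ℂ), x t), m t, n t))
  refine ⟨t₀, ht₀, ?_⟩
  have ht₀U := hVU (hBV ht₀)
  obtain ⟨τ', x', hfr, -, -, huniq⟩ :=
    E.exists_isPeriodFrameAt ht₀U (τ t₀) (hx t₀ ht₀) (hinv t₀ ht₀)
  have hfreq : ∃ᶠ t in 𝓝[≠] t₀, f t = (m t₀ * τ' t + n t₀) * x' t := by
    refine (hacc _ (prod_mem_nhds huniq
      (show {(m t₀, n t₀)} ∈ 𝓝 (m t₀, n t₀) from mem_nhds_discrete.mpr rfl))).mono ?_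
    rintro t ⟨htB, hp, hmn'⟩
    obtain ⟨hm, hn⟩ := Prod.mk.inj hmn'
    obtain ⟨h1, h2⟩ := Prod.mk.inj (hp t (hinv t htB))
    rw [hmn t htB, hm, hn, h1, h2]
  have hcomb : AnalyticAt ℂ (fun t ↦ (m t₀ * τ' t + n t₀) * x' t) t₀ :=
    ((analyticAt_const.mul hfr.analytic_ratio).add analyticAt_const).mul hfr.analytic_period
  have heq := ((hf.1 t₀ (hBV ht₀)).frequently_eq_iff_eventually_eq hcomb).mp hfreq
  rw [E.clearedPicardFuchs_congr heq]
  exact (hfr.clearedPicardFuchs_eq_zero hU ht₀U _ _).self_of_nhds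

lemma IsPeriodFunctionOn.clearedPicardFuchs_eq_zero {E : EllipticPencil U} {f : ℂ → ℂ}
    {V : Set ℂ} (hf : E.IsPeriodFunctionOn f V) (hU : IsOpen U) (hV : IsOpen V) (hVU : V ⊆ U)
    {t : ℂ} (ht : t ∈ V) : E.clearedPicardFuchs f t = 0 := by
  by_contra hne
  have hcont : ContinuousOn (E.clearedPicardFuchs f) V := fun s hs ↦
    (E.analyticAt_clearedPicardFuchs (hVU hs) (hf.1 s hs)).continuousAt.continuousWithinAt
  obtain ⟨s, hs, hs0⟩ := hf.exists_clearedPicardFuchs_eq_zero hU hVU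
    (hcont.isOpen_inter_preimage hV isOpen_compl_singleton) ⟨t, ht, hne⟩ Set.inter_subset_left
  exact hs.2 hs0

/-- The derivative of the functional invariant is a multiple of `gmOff`. -/
lemma hasDerivAt_j (E : EllipticPencil U) {t : ℂ} (ht : t ∈ U) :
    HasDerivAt E.j (-54 * E.g₂ t ^ 2 * E.g₃ t * E.gmOff t / E.disc t) t := by
  have h2 := (E.analytic_g₂ t ht).differentiableAt.hasDerivAt
  have h3 := (E.analytic_g₃ t ht).differentiableAt.hasDerivAt
  have hd : E.disc t ≠ 0 := E.disc_ne_zero t ht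
  convert! (h2.fun_pow 3).fun_div ((h2.fun_pow 3).fun_sub ((h3.fun_pow 2).const_mul 27))
    (E.disc_ne_zero t ht) using 1
  rw [gmOff, div_eq_div_iff hd (pow_ne_zero 2 (E.disc_ne_zero t ht))]
  field_simp
  rw [disc]
  push_cast
  ring

/-- If the functional invariant is not constant, the Gauss–Manin connection is nondegenerate away
from a discrete set. -/
lemma NonconstantJ.eventually_gmOff_ne_zero {E : EllipticPencil U} (hj : E.NonconstantJ)
    (hU : IsOpen U) (hconn : IsConnected U) : ∀ᶠ t in codiscreteWithin U, E.gmOff t ≠ 0 := by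
  have han : AnalyticOnNhd ℂ E.gmOff U := fun t ht ↦ E.analyticAt_gmOff ht
  refine (han.eqOn_zero_or_eventually_ne_zero_of_preconnected hconn.isPreconnected).resolve_left
    fun h0 ↦ hj ?_
  refine hU.exists_is_const_of_deriv_eq_zero hconn.isPreconnected
    (fun t ht ↦ (E.hasDerivAt_j ht).differentiableAt.differentiableWithinAt) fun t ht ↦ ?_
  rw [(E.hasDerivAt_j ht).deriv, h0 ht]
  simp

/-- The Picard–Fuchs operator of a pencil with nonconstant functional invariant, obtained by
eliminating the quasi-periods from the Gauss–Manin system. -/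
noncomputable def picardFuchs (E : EllipticPencil U) : DiffOp where
  a₁ t := -(deriv E.gmOff t / E.gmOff t)
  a₀ t := deriv E.gmDiag t - E.gmDiag t * (deriv E.gmOff t / E.gmOff t) - E.gmDiag t ^ 2 +
    3 / 4 * E.g₂ t * E.gmOff t ^ 2

lemma isPicardFuchs_picardFuchs (E : EllipticPencil U) (hj : E.NonconstantJ) (hU : IsOpen U)
    (hconn : IsConnected U) : E.IsPicardFuchs E.picardFuchs := by
  refine ⟨⟨fun t ht ↦ ?_, fun t ht ↦ ?_⟩, fun V hV hVU f hf ↦ ?_⟩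
  · have hw := (E.analyticAt_gmOff ht).meromorphicAt
    exact (hw.deriv.div hw).neg
  · have hw := (E.analyticAt_gmOff ht).meromorphicAt
    have hP := (E.analyticAt_gmDiag ht).meromorphicAt
    have hg := (E.analytic_g₂ t ht).meromorphicAt
    unfold picardFuchs
    fun_prop
  · filter_upwards [self_mem_codiscreteWithin V,
      codiscreteWithin_mono hVU (hj.eventually_gmOff_ne_zero hU hconn)] with t ht hw
    have h0 := hf.clearedPicardFuchs_eq_zero hU hV hVU ht
    have hw' : E.gmOff t ≠ 0 := hw
    rw [clearedPicardFuchs] at h0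
    rw [DiffOp.apply, picardFuchs, Pi.zero_apply, ← mul_right_injective₀ hw' |>.eq_iff, mul_zero,
      ← h0]
    field_simp
    ring

end EllipticPencil

lemma nhdsNE_le_codiscreteWithin {V : Set ℂ} (hV : IsOpen V) {t : ℂ} (ht : t ∈ V) :
    𝓝[≠] t ≤ codiscreteWithin V := by
  intro S hS
  have h := mem_codiscreteWithin_iff_forall_mem_nhdsNE.mp hS t ht
  filter_upwards [h, mem_nhdsWithin_of_mem_nhds (hV.mem_nhds ht)] with s hs hsV
  exact hs.resolve_right fun h ↦ h hsV

/-- The members of a period frame are period functions near `t₀`. -/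
lemma EllipticPencil.IsPicardFuchs.apply_frame_eq_zero {U : Set ℂ} {E : EllipticPencil U}
    {D : DiffOp} (hD : E.IsPicardFuchs D) (hU : IsOpen U) {τ x : ℂ → ℂ} {t₀ : ℂ} (ht₀ : t₀ ∈ U)
    (h : E.IsPeriodFrameAt τ x t₀) (m n : ℤ) :
    ∀ᶠ t in 𝓝[≠] t₀, D.apply (fun s ↦ (m * τ s + n) * x s) t = 0 := by
  obtain ⟨V, hV, hVo, ht₀V⟩ := eventually_nhds_iff.mp (h.eventually.and (hU.mem_nhds ht₀))
  refine nhdsNE_le_codiscreteWithin hVo ht₀V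
    (hD.2 V hVo (fun t ht ↦ (hV t ht).2) _ ⟨fun t ht ↦ ?_, fun t ht ↦ ?_⟩)
  · exact ((analyticAt_const.mul (hV t ht).1.analytic_ratio).add analyticAt_const).mul
      (hV t ht).1.analytic_period
  · have hfr := (hV t ht).1
    have hinv := PeriodPair.invariants_ofRatio ⟨τ t, hfr.im_pos⟩ (x t) hfr.ne_zero
    refine ⟨PeriodPair.ofRatio ⟨τ t, hfr.im_pos⟩ (x t) hfr.ne_zero,
      Prod.mk.inj (hinv.trans hfr.invariants_eq.self_of_nhds), ?_⟩
    exact PeriodPair.mem_lattice_ofRatio.mpr ⟨m, n, rfl⟩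

lemma EllipticPencil.IsPeriodFrameAt.wronskian {U : Set ℂ} {E : EllipticPencil U} {τ x : ℂ → ℂ}
    {t : ℂ} (h : E.IsPeriodFrameAt τ x t) (ht : t ∈ U) :
    x t * deriv (fun s ↦ τ s * x s) t - deriv x t * (τ t * x t) =
      -6 * Real.pi * I * E.gmOff t := by
  obtain ⟨h1, h2, -⟩ := h.hasDerivAt ht
  have hx := h.ne_zero
  rw [(h1.fun_mul h2).deriv, h2.deriv]
  field_simp
  ring

end PicardFuchs

/-! ### Conjugate operators and projective normal forms -/

section ProjectiveNormalForm

open Topology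

namespace DiffOp

/-- If `α f` and `α h` are solutions of `D₂` for two independent solutions `f`, `h` of `D₁`, then
`D₁` is the conjugate `α⁻¹ D₂ α`. -/
lemma coeffs_eq_of_apply_mul_eq_zero {D₁ D₂ : DiffOp} {α f h : ℂ → ℂ} {t : ℂ}
    (hα : AnalyticAt ℂ α t) (hf : AnalyticAt ℂ f t) (hh : AnalyticAt ℂ h t) (hα0 : α t ≠ 0)
    (hW : f t * deriv h t - deriv f t * h t ≠ 0) (h1f : D₁.apply f t = 0) (h1h : D₁.apply h t = 0)
    (h2f : D₂.apply (fun s ↦ α s * f s) t = 0) (h2h : D₂.apply (fun s ↦ α s * h s) t = 0) :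
    D₁.a₁ t = D₂.a₁ t + 2 * (deriv α t / α t) ∧
      D₁.a₀ t = D₂.a₀ t + D₂.a₁ t * (deriv α t / α t) + deriv (deriv α) t / α t := by
  have key : ∀ g : ℂ → ℂ, AnalyticAt ℂ g t → D₁.apply g t = 0 →
      D₂.apply (fun s ↦ α s * g s) t = 0 →
      (2 * deriv α t + D₂.a₁ t * α t - D₁.a₁ t * α t) * deriv g t +
        (deriv (deriv α) t + D₂.a₁ t * deriv α t + D₂.a₀ t * α t - D₁.a₀ t * α t) * g t = 0 := by
    intro g hg h1 h2
    have hd : ∀ s, AnalyticAt ℂ α s → AnalyticAt ℂ g s →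
        HasDerivAt (fun s ↦ α s * g s) (deriv α s * g s + α s * deriv g s) s := fun s h h' ↦
      h.differentiableAt.hasDerivAt.fun_mul h'.differentiableAt.hasDerivAt
    have hev : deriv (fun s ↦ α s * g s) =ᶠ[𝓝 t] fun s ↦ deriv α s * g s + α s * deriv g s := by
      filter_upwards [hα.eventually_analyticAt, hg.eventually_analyticAt] with s h h'
      exact (hd s h h').deriv
    have hdd := (hα.deriv.differentiableAt.hasDerivAt.fun_mul
      hg.differentiableAt.hasDerivAt).fun_add
      (hα.differentiableAt.hasDerivAt.fun_mul hg.deriv.differentiableAt.hasDerivAt)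
    rw [apply, hev.deriv_eq, hdd.deriv, (hd t hα hg).deriv] at h2
    rw [apply] at h1
    linear_combination h2 - α t * h1
  have hf' := key f hf h1f h2f
  have hh' := key h hh h1h h2h
  have hA := (mul_eq_zero.mp (by linear_combination f t * hh' - h t * hf' :
    (2 * deriv α t + D₂.a₁ t * α t - D₁.a₁ t * α t) *
      (f t * deriv h t - deriv f t * h t) = 0)).resolve_right hW
  have hB := (mul_eq_zero.mp (by linear_combination deriv h t * hf' - deriv f t * hh' :
    (deriv (deriv α) t + D₂.a₁ t * deriv α t + D₂.a₀ t * α t - D₁.a₀ t * α t) *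
      (f t * deriv h t - deriv f t * h t) = 0)).resolve_right hW
  constructor
  · field_simp
    linear_combination -hA
  · field_simp
    linear_combination -hB

/-- Conjugation by a function does not change the projective normal form. -/
lemma projectiveNormalForm_eq_of_conjugate {D₁ D₂ : DiffOp} {α : ℂ → ℂ} {t : ℂ}
    (hα : AnalyticAt ℂ α t) (hα0 : α t ≠ 0) (hD₂ : AnalyticAt ℂ D₂.a₁ t)
    (h1 : ∀ᶠ s in 𝓝 t, D₁.a₁ s = D₂.a₁ s + 2 * (deriv α s / α s))
    (h0 : D₁.a₀ t = D₂.a₀ t + D₂.a₁ t * (deriv α t / α t) + deriv (deriv α) t / α t) :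
    D₁.projectiveNormalForm.a₀ t = D₂.projectiveNormalForm.a₀ t := by
  have hd : deriv D₁.a₁ t = deriv D₂.a₁ t +
      2 * ((deriv (deriv α) t * α t - deriv α t * deriv α t) / α t ^ 2) := by
    have h := hD₂.differentiableAt.hasDerivAt.fun_add
      ((hα.deriv.differentiableAt.hasDerivAt.fun_div
        hα.differentiableAt.hasDerivAt hα0).const_mul 2)
    exact (h.congr_of_eventuallyEq h1).deriv
  simp only [projectiveNormalForm, hd, h0, h1.self_of_nhds]
  field_simp
  ring

lemma IsMeromorphicOn.projectiveNormalForm {D : DiffOp} {U : Set ℂ} (h : D.IsMeromorphicOn U) :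
    MeromorphicOn D.projectiveNormalForm.a₀ U := by
  intro t ht
  have h1 := h.1 t ht
  have h0 := h.2 t ht
  unfold DiffOp.projectiveNormalForm
  fun_prop

/-- Identity principle: on a connected open set, it suffices to compare projective normal forms
near one point. -/
lemma identical_projectiveNormalForm_of_eventuallyEq {D₁ D₂ : DiffOp} {U : Set ℂ}
    (hconn : IsConnected U) (h₁ : D₁.IsMeromorphicOn U) (h₂ : D₂.IsMeromorphicOn U) {t₀ : ℂ}
    (ht₀ : t₀ ∈ U) (h : D₁.projectiveNormalForm.a₀ =ᶠ[𝓝[≠] t₀] D₂.projectiveNormalForm.a₀) :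
    Identical U D₁.projectiveNormalForm D₂.projectiveNormalForm := by
  refine ⟨Eventually.of_forall fun _ ↦ rfl, ?_⟩
  have hm : MeromorphicOn (D₁.projectiveNormalForm.a₀ - D₂.projectiveNormalForm.a₀) U :=
    h₁.projectiveNormalForm.sub h₂.projectiveNormalForm
  have h0 : meromorphicOrderAt
      (D₁.projectiveNormalForm.a₀ - D₂.projectiveNormalForm.a₀) t₀ = ⊤ := by
    rw [meromorphicOrderAt_eq_top_iff]
    filter_upwards [h] with t ht
    simp [ht]
  refine mem_codiscreteWithin_iff_forall_mem_nhdsNE.mpr fun t ht ↦ ?_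
  have htop : meromorphicOrderAt
      (D₁.projectiveNormalForm.a₀ - D₂.projectiveNormalForm.a₀) t = ⊤ := by
    by_contra hne
    exact hm.meromorphicOrderAt_ne_top_of_isPreconnected hconn.isPreconnected ht ht₀ hne h0
  rw [meromorphicOrderAt_eq_top_iff] at htop
  filter_upwards [htop] with s hs
  exact Or.inl (sub_eq_zero.mp hs)

end DiffOp

end ProjectiveNormalForm

/-! ### Isogenous pencils -/

section Isogeny

open UpperHalfPlane hiding I
open Complex Topology

/-- For oriented bases `(τ₁ x₁, x₁)` and `(τ₂ x₂, x₂)`, an isogeny expresses `τ₁` as a fractional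
linear transform of `τ₂` with integral coefficients. -/
lemma AdmitFiberwiseIsogeny.exists_bases {U : Set ℂ} {k : ℕ} {E₁ E₂ : EllipticPencil U}
    (h : AdmitFiberwiseIsogeny k E₁ E₂) {t : ℂ} (ht : t ∈ U) :
    ∃ (τ₁ τ₂ : ℍ) (x₁ x₂ : ℂ) (a b c d : ℤ), x₁ ≠ 0 ∧ x₂ ≠ 0 ∧
      invariants (τ₁, x₁) = (E₁.g₂ t, E₁.g₃ t) ∧ invariants (τ₂, x₂) = (E₂.g₂ t, E₂.g₃ t) ∧
      (c * τ₂ + d : ℂ) ≠ 0 ∧ (τ₁ : ℂ) * (c * τ₂ + d) = a * τ₂ + b := by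
  obtain ⟨L₁, L₂, hL₁, hL₂, α, hα, hsub, -⟩ := h t ht
  obtain ⟨τ₁, x₁, hx₁, hinv₁, hmem₁⟩ := hL₁.exists_basis
  obtain ⟨τ₂, x₂, hx₂, hinv₂, hmem₂⟩ := hL₂.exists_basis
  have hmul : ∀ z ∈ L₁.lattice, α * z ∈ L₂.lattice := fun z hz ↦ hsub ⟨z, hz, rfl⟩
  obtain ⟨a, b, hab⟩ := (hmem₂ _).mp (hmul (τ₁ * x₁) ((hmem₁ _).mpr ⟨1, 0, by simp⟩))
  obtain ⟨c, d, hcd⟩ := (hmem₂ _).mp (hmul x₁ ((hmem₁ _).mpr ⟨0, 1, by simp⟩))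
  refine ⟨τ₁, τ₂, x₁, x₂, a, b, c, d, hx₁, hx₂, hinv₁, hinv₂, fun h0 ↦ ?_, ?_⟩
  · rw [h0, zero_mul] at hcd
    exact mul_ne_zero hα hx₁ hcd
  · apply mul_right_cancel₀ hx₂
    linear_combination hab - τ₁ * hcd

/-- For fibrewise isogenous pencils there are period frames near some point whose ratios are related
by a constant integral fractional linear transformation. -/
lemma AdmitFiberwiseIsogeny.exists_frames {U : Set ℂ} {k : ℕ} {E₁ E₂ : EllipticPencil U}
    (h : AdmitFiberwiseIsogeny k E₁ E₂) (hU : IsOpen U) (hne : U.Nonempty) :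
    ∃ t₀ ∈ U, ∃ (τ₁ x₁ τ₂ x₂ : ℂ → ℂ) (a b c d : ℤ), E₁.IsPeriodFrameAt τ₁ x₁ t₀ ∧
      E₂.IsPeriodFrameAt τ₂ x₂ t₀ ∧ (c * τ₂ t₀ + d : ℂ) ≠ 0 ∧
      ∀ᶠ t in 𝓝 t₀, τ₁ t * (c * τ₂ t + d) = a * τ₂ t + b := by
  have hchoice := fun t (ht : t ∈ U) ↦ h.exists_bases ht
  choose! τ₁ τ₂ x₁ x₂ a b c d hx₁ hx₂ hinv₁ hinv₂ hcd hrel using hchoice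
  obtain ⟨t₀, ht₀, hacc⟩ := exists_frequently_mem_of_not_countable (not_countable_of_isOpen hU hne)
    (fun t ↦ (((τ₁ t : ℂ), x₁ t), ((τ₂ t : ℂ), x₂ t), a t, b t, c t, d t))
  obtain ⟨σ₁, y₁, hfr₁, -, -, huniq₁⟩ :=
    E₁.exists_isPeriodFrameAt ht₀ (τ₁ t₀) (hx₁ t₀ ht₀) (hinv₁ t₀ ht₀)
  obtain ⟨σ₂, y₂, hfr₂, hσ₂, -, huniq₂⟩ :=
    E₂.exists_isPeriodFrameAt ht₀ (τ₂ t₀) (hx₂ t₀ ht₀) (hinv₂ t₀ ht₀)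
  refine ⟨t₀, ht₀, σ₁, y₁, σ₂, y₂, a t₀, b t₀, c t₀, d t₀, hfr₁, hfr₂, ?_, ?_⟩
  · rw [hσ₂]
    exact hcd t₀ ht₀
  · have hfreq : ∃ᶠ t in 𝓝[≠] t₀, σ₁ t * (c t₀ * σ₂ t + d t₀) = a t₀ * σ₂ t + b t₀ := by
      refine (hacc _ (prod_mem_nhds huniq₁ (prod_mem_nhds huniq₂
        (show {(a t₀, b t₀, c t₀, d t₀)} ∈ 𝓝 (a t₀, b t₀, c t₀, d t₀) from
          mem_nhds_discrete.mpr rfl)))).mono ?_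
      rintro t ⟨htU, hp₁, hp₂, habcd⟩
      simp only [Set.mem_singleton_iff, Prod.mk.injEq] at habcd
      obtain ⟨ha, hb, hc, hd⟩ := habcd
      obtain ⟨h1, -⟩ := Prod.mk.inj (hp₁ t (hinv₁ t htU))
      obtain ⟨h2, -⟩ := Prod.mk.inj (hp₂ t (hinv₂ t htU))
      rw [← ha, ← hb, ← hc, ← hd, ← h1, ← h2]
      exact hrel t htU
    exact ((hfr₁.analytic_ratio.mul ((analyticAt_const.mul hfr₂.analytic_ratio).add
      analyticAt_const)).frequently_eq_iff_eventually_eq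
      ((analyticAt_const.mul hfr₂.analytic_ratio).add analyticAt_const)).mp hfreq

/-- Near a suitable point the periods of the second pencil include the products of those of the
first with a nonvanishing function, so the two Picard–Fuchs operators are conjugate there. -/
lemma AdmitFiberwiseIsogeny.exists_projectiveNormalForm_eventuallyEq {U : Set ℂ} {k : ℕ}
    {E₁ E₂ : EllipticPencil U} (h : AdmitFiberwiseIsogeny k E₁ E₂) (hU : IsOpen U)
    (hconn : IsConnected U) (hj₁ : E₁.NonconstantJ) {D₁ D₂ : DiffOp} (hD₁ : E₁.IsPicardFuchs D₁)
    (hD₂ : E₂.IsPicardFuchs D₂) : ∃ t₀ ∈ U,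
      D₁.projectiveNormalForm.a₀ =ᶠ[𝓝[≠] t₀] D₂.projectiveNormalForm.a₀ := by
  obtain ⟨t₀, ht₀, τ₁, x₁, τ₂, x₂, a, b, c, d, hfr₁, hfr₂, hcd, hrel⟩ :=
    h.exists_frames hU hconn.nonempty
  refine ⟨t₀, ht₀, ?_⟩
  set α : ℂ → ℂ := fun t ↦ (c * τ₂ t + d) * x₂ t / x₁ t
  have hα : AnalyticAt ℂ α t₀ := (((analyticAt_const.mul hfr₂.analytic_ratio).add
    analyticAt_const).mul hfr₂.analytic_period).div hfr₁.analytic_period hfr₁.ne_zero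
  have hα0 : α t₀ ≠ 0 := div_ne_zero (mul_ne_zero hcd hfr₂.ne_zero) hfr₁.ne_zero
  have hx : ∀ᶠ t in 𝓝 t₀, (fun s ↦ α s * x₁ s) =ᶠ[𝓝 t] fun s ↦ (c * τ₂ s + d) * x₂ s := by
    refine Eventually.eventually_nhds ?_
    filter_upwards [hfr₁.eventually] with t ht
    exact div_mul_cancel₀ _ ht.ne_zero
  have hy : ∀ᶠ t in 𝓝 t₀,
      (fun s ↦ α s * (τ₁ s * x₁ s)) =ᶠ[𝓝 t] fun s ↦ (a * τ₂ s + b) * x₂ s := by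
    refine Eventually.eventually_nhds ?_
    filter_upwards [hfr₁.eventually, hrel] with t ht hr
    have := ht.ne_zero
    simp only [α]
    field_simp
    linear_combination x₂ t * hr
  have hcongr : ∀ {f g : ℂ → ℂ} {t : ℂ}, f =ᶠ[𝓝 t] g → D₂.apply f t = D₂.apply g t := by
    intro f g t hfg
    rw [DiffOp.apply, DiffOp.apply, hfg.deriv.deriv_eq, hfg.deriv_eq, hfg.self_of_nhds]
  have hcoeff : ∀ᶠ t in 𝓝[≠] t₀, D₁.a₁ t = D₂.a₁ t + 2 * (deriv α t / α t) ∧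
      D₁.a₀ t = D₂.a₀ t + D₂.a₁ t * (deriv α t / α t) + deriv (deriv α) t / α t := by
    filter_upwards [nhdsWithin_le_nhds hfr₁.eventually, nhdsWithin_le_nhds (hU.mem_nhds ht₀),
      nhdsWithin_le_nhds hα.eventually_analyticAt,
      nhdsWithin_le_nhds (hα.continuousAt.eventually_ne hα0),
      nhdsWithin_le_nhds hx, nhdsWithin_le_nhds hy,
      nhdsNE_le_codiscreteWithin hU ht₀ (hj₁.eventually_gmOff_ne_zero hU hconn),
      hD₁.apply_frame_eq_zero hU ht₀ hfr₁ 0 1, hD₁.apply_frame_eq_zero hU ht₀ hfr₁ 1 0,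
      hD₂.apply_frame_eq_zero hU ht₀ hfr₂ c d, hD₂.apply_frame_eq_zero hU ht₀ hfr₂ a b]
      with t hfr htU hαt hα0t hxt hyt hw h01 h10 hcd' hab'
    simp only [Int.cast_zero, Int.cast_one, zero_mul, zero_add, one_mul, add_zero] at h01 h10
    refine DiffOp.coeffs_eq_of_apply_mul_eq_zero hαt hfr.analytic_period
      (hfr.analytic_ratio.mul hfr.analytic_period) hα0t ?_ h01 h10 ((hcongr hxt).trans hcd')
      ((hcongr hyt).trans hab')
    have hw' : E₁.gmOff t ≠ 0 := hw
    refine (hfr.wronskian htU).trans_ne ?_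
    simp [Real.pi_ne_zero, hw']
  filter_upwards [nhdsWithin_le_nhds hα.eventually_analyticAt,
    nhdsWithin_le_nhds (hα.continuousAt.eventually_ne hα0),
    (hD₂.1.1 t₀ ht₀).eventually_analyticAt, hcoeff,
    eventually_nhdsNE_eventually_nhds_iff.mpr hcoeff] with t h1 h2 h3 h4 h5
  exact DiffOp.projectiveNormalForm_eq_of_conjugate h1 h2 h3 (h5.mono fun s hs ↦ hs.1) h4.2

end Isogeny

theorem mainTheorem2 (n : ℕ) (hn : 1 ≤ n) (hgenus : genusX0Plus n = 0)
    (U : Set ℂ) (hUopen : IsOpen U) (hUconn : IsConnected U)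
    (E₁ E₂ : EllipticPencil U) (hj₁ : E₁.NonconstantJ) (hj₂ : E₂.NonconstantJ)
    (hisog : AdmitFiberwiseIsogeny n E₁ E₂) :
    (∃ D₁ : DiffOp, E₁.IsPicardFuchs D₁) ∧ (∃ D₂ : DiffOp, E₂.IsPicardFuchs D₂) ∧
      ∀ D₁ D₂ : DiffOp, E₁.IsPicardFuchs D₁ → E₂.IsPicardFuchs D₂ →
        DiffOp.Identical U D₁.projectiveNormalForm D₂.projectiveNormalForm := by
  refine ⟨⟨_, E₁.isPicardFuchs_picardFuchs hj₁ hUopen hUconn⟩,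
    ⟨_, E₂.isPicardFuchs_picardFuchs hj₂ hUopen hUconn⟩, fun D₁ D₂ hD₁ hD₂ ↦ ?_⟩
  obtain ⟨t₀, ht₀, h⟩ :=
    hisog.exists_projectiveNormalForm_eventuallyEq hUopen hUconn hj₁ hD₁ hD₂
  exact DiffOp.identical_projectiveNormalForm_of_eventuallyEq hUconn hD₁.1 hD₂.1 ht₀ h
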